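/- Let $(M,d,\mu)$ be a doubling metric measure space: $(M,d)$ is a metric space and $\mu$ is a Borel measure on $M$ such that every open ball $B(x,r)$, $r>0$, has measure $0<\mu(B(x,r))<\infty$ and, for some constant $K$, $\mu(B(x,2r))\le K\,\mu(B(x,r))$ for all $x\in M$ and $r>0$. For a measurable function $F: M\times(0,\infty)\to\mathbb{C}$ and $q\in(1,\infty)$, let $$N_*(F)(x):=\sup\{|F(y,t)| : y\in M,\ t>0,\ d(y,x)<\sqrt t\},$$ $$\mathscr{C}_q(F)(x):=\sup_{B\ni x}\left(\frac{1}{\mu(B)}\int_B\left(\int_0^{r(B)^2}|F(y,t)|^2\,\frac{dt}{t}\right)^{q/2}d\mu(y)\right)^{1/q},\qquad x\in M,$$ where the supremum is over all open balls $B=B(c,r)$, $c\in M$, $r=r(B)>0$, that contain $x$. Let $p\in[2,\infty)$, and let $\epsilon>0$, where $\epsilon=0$ is also allowed if $p=2$. Then there is a constant $C>0$ such that for all measurable functions $F,G: M\times(0,\infty)\to\mathbb{C}$, $$\left(\int_M\left(\int_0^\infty|F(x,t)|^2|G(x,t)|^2\,\frac{dt}{t}\right)^{p/2}d\mu(x)\right)^{1/p}\le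 C\,\|N_*(F)\|_{L^p(M,\mu)}\,\|\mathscr{C}_{p+\epsilon}(G)\|_{L^\infty(M,\mu)},$$ where all quantities take values in $[0,\infty]$ and $0\cdot\infty=0$. -/

import Mathlib

open MeasureTheory Metric Set
open scoped ENNReal NNReal

noncomputable section

namespace CarlesonDuality

/-- `(M, d, μ)` is a doubling metric measure space: all balls have positive and finite measure and
`V(x, 2r) ≤ K V(x, r)` for all `x` and all `r > 0`, with one constant `K`. -/
structure IsDoublingSpace {M : Type*} [MetricSpace M] [MeasurableSpace M] (μ : Measure M) :
    Prop where
  pos : ∀ (x : M) (r : ℝ), 0 < r → 0 < μ (ball x r)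
  lt_top : ∀ (x : M) (r : ℝ), 0 < r → μ (ball x r) < ∞
  doubling : ∃ K : ℝ≥0, ∀ (x : M) (r : ℝ), 0 < r → μ (ball x (2 * r)) ≤ K * μ (ball x r)

/-- The measure `dt / t` on `(0, ∞)`. -/
def dtOverT : Measure (Ioi (0 : ℝ)) :=
  ((volume : Measure ℝ).comap (Subtype.val : Ioi (0 : ℝ) → ℝ)).withDensity
    (fun t => ENNReal.ofReal (t : ℝ)⁻¹)

/-- The parabolic cone of aperture `1` with vertex `x`. -/
def cone {M : Type*} [MetricSpace M] (x : M) : Set (M × Ioi (0 : ℝ)) :=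
  {z | dist z.1 x < Real.sqrt (z.2 : ℝ)}

/-- The non-tangential maximal function `N_*(F)`, with values in `[0, ∞]`. -/
def nontangentialMax {M : Type*} [MetricSpace M] (F : M × Ioi (0 : ℝ) → ℂ) (x : M) : ℝ≥0∞ :=
  ⨆ z ∈ cone x, ‖F z‖ₑ

/-- The `L^q`-Carleson function `C_q(G)`, with values in `[0, ∞]`: the supremum runs over all open
balls `B = ball c r` that contain `x`, and the Carleson box over `B` has the parabolic height
`r ^ 2`. -/
def carlesonFun {M : Type*} [MetricSpace M] [MeasurableSpace M] (μ : Measure M) (q : ℝ)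
    (G : M × Ioi (0 : ℝ) → ℂ) (x : M) : ℝ≥0∞ :=
  ⨆ (c : M) (r : ℝ) (_ : 0 < r) (_ : x ∈ ball c r),
    (⨍⁻ y in ball c r,
      (∫⁻ t in {t : Ioi (0 : ℝ) | (t : ℝ) < r ^ 2}, ‖G (y, t)‖ₑ ^ 2 ∂dtOverT) ^ (q / 2) ∂μ) ^ (1 / q)

end CarlesonDuality

end

/-!
The inequality is proved directly, by combining a layer cake decomposition in the height of `F` with
Hölder's inequality; neither duality nor the Hardy-Littlewood maximal theorem is used.

Write `N = N_*(F)`, `r = p / 2`, `s = (p + ε) / 2`, let `a` be the `L^∞` norm of `C_{p + ε}(G)`, and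
let `g_l(x)` be the integral of `|G(x, t)|² dt / t` over those `t` for which `|F(x, t)| > l`.

* If `|F(y, t)| > l`, then the ball `B(y, √t)` lies in the open set `{N > l}`. So `g_l` only sees
  the tent over `{N > l}`. The Vitali covering lemma selects disjoint balls in this set, and the
  Carleson condition on their fourfold enlargements gives
  `∫ g_l ^ s dμ ≤ K² a ^ (2 s) μ {N > l}`, where `K` is the doubling constant
  (`lintegral_rpow_le_of_tent`). Integrating against `l ^ (p - 1) dl` bounds the integral of
  `W(x) = ∫ g_l(x) ^ s l ^ (p - 1) dl` by `K² a ^ (2 s) p⁻¹ ∫ N ^ p dμ`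
  (`lintegral_superlevelIntegral_le`).
* Pointwise, `∫ |F|² |G|² dt / t = 2 ∫_0^{N(x)} l g_l(x) dl`
  (`lintegral_sq_mul_eq_superlevelIntegral`), and Hölder's inequality in `l` bounds the `r`-th power
  of the right-hand side by a constant times `(N ^ p) ^ (1 - r / s) W ^ (r / s)`
  (`exists_rpow_setLIntegral_heights_le`). This is where `r < s` is needed: the weight
  complementary to `g_l ^ s l ^ (p - 1)` is integrable at `l = 0` only if `r < s`. For `r = s = 1`
  Hölder's inequality is not needed.

Hölder's inequality in `x` with exponents `1 - r / s` and `r / s` combines the two bounds.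
-/

noncomputable section

namespace CarlesonDuality

open Filter Topology

/-! ### Integrals of powers over bounded heights -/

/-- The set of heights `l > 0` lying strictly below `c ∈ [0, ∞]`. -/
def heights (c : ℝ≥0∞) : Set ℝ := {l | 0 < l ∧ ENNReal.ofReal l < c}

lemma measurableSet_heights (c : ℝ≥0∞) : MeasurableSet (heights c) :=
  (measurableSet_Ioi (a := (0 : ℝ))).inter (ENNReal.measurable_ofReal measurableSet_Iio)

lemma heights_mono {c d : ℝ≥0∞} (h : c ≤ d) : heights c ⊆ heights d :=
  fun _ hl => ⟨hl.1, hl.2.trans_le h⟩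

lemma setLIntegral_heights_of_ne_top {a : ℝ} (ha : 0 < a) {c : ℝ≥0∞} (hc : c ≠ ∞) :
    ∫⁻ l in heights c, ENNReal.ofReal (l ^ (a - 1)) = c ^ a / ENNReal.ofReal a := by
  lift c to ℝ≥0 using hc
  have hset : heights (c : ℝ≥0∞) = Ioo 0 (c : ℝ) := by
    ext l
    simp only [heights, mem_ofPred_eq, mem_Ioo]
    refine and_congr_right fun hl => ?_
    rw [← ENNReal.ofReal_coe_nnreal, ENNReal.ofReal_lt_ofReal_iff_of_nonneg hl.le]
  have hint : IntegrableOn (fun l : ℝ => l ^ (a - 1)) (Ioo 0 (c : ℝ)) := by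
    have := (intervalIntegral.intervalIntegrable_rpow' (a := 0) (b := (c : ℝ))
      (by linarith : -1 < a - 1))
    rw [intervalIntegrable_iff_integrableOn_Ioo_of_le c.coe_nonneg] at this
    exact this
  rw [hset, ← ofReal_integral_eq_lintegral_ofReal hint, ← integral_Ioc_eq_integral_Ioo,
    ← intervalIntegral.integral_of_le c.coe_nonneg, integral_rpow (Or.inl (by linarith))]
  · rw [sub_add_cancel, Real.zero_rpow ha.ne', sub_zero, ENNReal.ofReal_div_of_pos ha,
      ← ENNReal.ofReal_rpow_of_nonneg c.coe_nonneg ha.le, ENNReal.ofReal_coe_nnreal]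
  · exact (ae_restrict_iff' measurableSet_Ioo).2
      (ae_of_all _ fun l hl => Real.rpow_nonneg hl.1.le _)

lemma setLIntegral_heights_le {a : ℝ} (ha : 0 < a) (c : ℝ≥0∞) :
    ∫⁻ l in heights c, ENNReal.ofReal (l ^ (a - 1)) ≤ c ^ a / ENNReal.ofReal a := by
  rcases eq_or_ne c ∞ with rfl | hc
  · rw [ENNReal.top_rpow_of_pos ha, ENNReal.top_div_of_ne_top ENNReal.ofReal_ne_top]
    exact le_top
  · exact (setLIntegral_heights_of_ne_top ha hc).le

/-! ### Superlevel integrals and the layer cake formula -/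

instance : SFinite dtOverT := by
  have : SigmaFinite ((volume : Measure ℝ).comap (Subtype.val : Ioi (0 : ℝ) → ℝ)) := by
    refine SigmaFinite.of_map _ measurable_subtype_coe.aemeasurable ?_
    rw [(MeasurableEmbedding.subtype_coe measurableSet_Ioi).map_comap]
    infer_instance
  unfold dtOverT
  infer_instance

variable {M : Type*}

/-- The integral of `ψ` with respect to `dt / t` over the part of the vertical ray above `x` on
which `φ` exceeds `l`. -/
def superlevelIntegral (φ ψ : M × Ioi (0 : ℝ) → ℝ≥0∞) (l : ℝ) (x : M) : ℝ≥0∞ :=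
  ∫⁻ t, {z | ENNReal.ofReal l < φ z}.indicator ψ (x, t) ∂dtOverT

section

variable [MeasurableSpace M]

lemma measurable_indicator_superlevel {φ ψ : M × Ioi (0 : ℝ) → ℝ≥0∞} (hφ : Measurable φ)
    (hψ : Measurable ψ) : Measurable fun w : ℝ × (M × Ioi (0 : ℝ)) =>
      {z | ENNReal.ofReal w.1 < φ z}.indicator ψ w.2 := by
  have : (fun w : ℝ × (M × Ioi (0 : ℝ)) => {z | ENNReal.ofReal w.1 < φ z}.indicator ψ w.2)
      = {w : ℝ × (M × Ioi (0 : ℝ)) | ENNReal.ofReal w.1 < φ w.2}.indicator fun w => ψ w.2 := by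
    ext w
    simp [indicator_apply]
  rw [this]
  exact (hψ.comp measurable_snd).indicator (measurableSet_lt
    (ENNReal.measurable_ofReal.comp measurable_fst) (hφ.comp measurable_snd))

lemma measurable_superlevelIntegral {φ ψ : M × Ioi (0 : ℝ) → ℝ≥0∞} (hφ : Measurable φ)
    (hψ : Measurable ψ) : Measurable fun w : ℝ × M => superlevelIntegral φ ψ w.1 w.2 := by
  have h := (measurable_indicator_superlevel hφ hψ).comp
    (MeasurableEquiv.prodAssoc (α := ℝ) (β := M) (γ := Ioi (0 : ℝ))).measurable
  exact h.lintegral_prod_right'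

lemma measurable_superlevelIntegral_right {φ ψ : M × Ioi (0 : ℝ) → ℝ≥0∞} (hφ : Measurable φ)
    (hψ : Measurable ψ) (x : M) : Measurable fun l : ℝ => superlevelIntegral φ ψ l x :=
  (measurable_superlevelIntegral hφ hψ).comp (measurable_id.prodMk measurable_const)

/-- Layer cake in the height of `φ`: the integral of `φ ^ 2 * ψ` along a vertical ray is a weighted
integral of the superlevel integrals, and only heights below an upper bound of `φ` matter. -/
lemma lintegral_sq_mul_eq_superlevelIntegral {φ ψ : M × Ioi (0 : ℝ) → ℝ≥0∞} (hφ : Measurable φ)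
    (hψ : Measurable ψ) (hfin : ∀ z, φ z ≠ ∞) {x : M} {N : ℝ≥0∞} (hN : ∀ t, φ (x, t) ≤ N) :
    ∫⁻ t, φ (x, t) ^ 2 * ψ (x, t) ∂dtOverT
      = 2 * ∫⁻ l in heights N, ENNReal.ofReal l * superlevelIntegral φ ψ l x := by
  have hsq : ∀ t, φ (x, t) ^ 2 * ψ (x, t) = 2 * ∫⁻ l in heights N,
      ENNReal.ofReal l * {z | ENNReal.ofReal l < φ z}.indicator ψ (x, t) := by
    intro t
    have h := setLIntegral_heights_of_ne_top (a := 2) (by norm_num) (hfin (x, t))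
    have h2 : φ (x, t) ^ 2 = 2 * ∫⁻ l in heights (φ (x, t)), ENNReal.ofReal l := by
      have e : (2 : ℝ) - 1 = 1 := by norm_num
      simp only [e, Real.rpow_one] at h
      rw [h, ENNReal.ofReal_ofNat, ENNReal.rpow_ofNat,
        ENNReal.mul_div_cancel (by norm_num) (by norm_num)]
    rw [h2, mul_assoc, ← lintegral_mul_const _ ENNReal.measurable_ofReal,
      ← lintegral_indicator (measurableSet_heights _),
      ← lintegral_indicator (measurableSet_heights _)]
    congr 1
    refine lintegral_congr fun l => ?_
    by_cases hl : l ∈ heights (φ (x, t))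
    · rw [indicator_of_mem hl, indicator_of_mem (heights_mono (hN t) hl),
        indicator_of_mem (show (x, t) ∈ {z | ENNReal.ofReal l < φ z} from hl.2)]
    · rw [indicator_of_notMem hl]
      by_cases hl' : l ∈ heights N
      · rw [indicator_of_mem hl', indicator_of_notMem, mul_zero]
        exact fun h => hl ⟨hl'.1, h⟩
      · rw [indicator_of_notMem hl']
  have hmeas : Measurable fun w : Ioi (0 : ℝ) × ℝ =>
      ENNReal.ofReal w.2 * {z | ENNReal.ofReal w.2 < φ z}.indicator ψ (x, w.1) :=
    (ENNReal.measurable_ofReal.comp measurable_snd).mul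
      ((measurable_indicator_superlevel hφ hψ).comp
        (measurable_snd.prodMk (measurable_const.prodMk measurable_fst)))
  simp_rw [hsq]
  rw [lintegral_const_mul _ hmeas.lintegral_prod_right',
    lintegral_lintegral_swap hmeas.aemeasurable]
  congr 1
  refine lintegral_congr fun l => ?_
  have hl : Measurable fun t => {z | ENNReal.ofReal l < φ z}.indicator ψ (x, t) :=
    (measurable_indicator_superlevel hφ hψ).comp
      (measurable_const.prodMk (measurable_const.prodMk measurable_id))
  exact lintegral_const_mul (ENNReal.ofReal l) hl

end

/-! ### Hölder's inequality in the height -/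

/-- The weighted Hölder inequality in the height variable. With `u = 2 r / s`, which is `< 2` if
`r < s`, and `s'` the exponent conjugate to `s`, the integrand splits as
`l g = (g ^ s l ^ (2 r - 1)) ^ (1 / s) (l ^ ((2 - u) s' - 1)) ^ (1 / s')`,
and the second factor is integrable near `0`. -/
lemma exists_rpow_setLIntegral_heights_le {r s : ℝ} (hr : 1 ≤ r) (hs : r < s ∨ (r = 1 ∧ s = 1)) :
    ∃ C : ℝ≥0, ∀ (N : ℝ≥0∞) (g : ℝ → ℝ≥0∞), Measurable g →
      (2 * ∫⁻ l in heights N, ENNReal.ofReal l * g l) ^ r ≤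
        C * ((N ^ (2 * r)) ^ (1 - r / s) *
          (∫⁻ l in heights N, g l ^ s * ENNReal.ofReal (l ^ (2 * r - 1))) ^ (r / s)) := by
  rcases hs with hs | ⟨rfl, rfl⟩
  · have hs0 : 0 < s := by linarith
    have hr0 : 0 < r := by linarith
    have hs1 : 0 < s - 1 := by linarith
    -- `a - 1` is the power of the height that is left for the second factor
    set a : ℝ := (2 - 2 * r / s) * (s / (s - 1)) with ha
    have hu : 0 < 2 - 2 * r / s := by
      rw [sub_pos, div_lt_iff₀ hs0]; linarith
    have ha0 : 0 < a := by positivity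
    have hq : 0 < 1 - 1 / s := by
      rw [sub_pos, div_lt_iff₀ hs0]; linarith
    set c : ℝ≥0∞ := 2 ^ r * ((ENNReal.ofReal a)⁻¹ ^ (1 - 1 / s)) ^ r with hcdef
    have hc : c ≠ ∞ := by
      refine ENNReal.mul_ne_top (ENNReal.rpow_ne_top_of_nonneg hr0.le (by norm_num)) ?_
      refine ENNReal.rpow_ne_top_of_nonneg hr0.le (ENNReal.rpow_ne_top_of_nonneg hq.le ?_)
      rw [ENNReal.inv_ne_top]
      exact (ENNReal.ofReal_pos.2 ha0).ne'
    refine ⟨c.toNNReal, fun N g hg => ?_⟩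
    rw [ENNReal.coe_toNNReal hc]
    set W := ∫⁻ l in heights N, g l ^ s * ENNReal.ofReal (l ^ (2 * r - 1)) with hW
    have hsplit : ∫⁻ l in heights N, ENNReal.ofReal l * g l
        = ∫⁻ l in heights N, (g l ^ s * ENNReal.ofReal (l ^ (2 * r - 1))) ^ (1 / s) *
            (ENNReal.ofReal (l ^ (a - 1))) ^ (1 - 1 / s) := by
      refine setLIntegral_congr_fun (measurableSet_heights N) fun l hl => ?_
      have hl0 : 0 < l := hl.1
      rw [ENNReal.mul_rpow_of_nonneg _ _ (by positivity), ← ENNReal.rpow_mul,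
        mul_one_div_cancel hs0.ne', ENNReal.rpow_one,
        ENNReal.ofReal_rpow_of_nonneg (by positivity) (by positivity),
        ENNReal.ofReal_rpow_of_nonneg (by positivity) hq.le, mul_assoc,
        ← ENNReal.ofReal_mul (by positivity), ← Real.rpow_mul hl0.le, ← Real.rpow_mul hl0.le,
        ← Real.rpow_add hl0, mul_comm]
      have : (2 * r - 1) * (1 / s) + (a - 1) * (1 - 1 / s) = 1 := by
        rw [ha]; field_simp; ring
      rw [this, Real.rpow_one]
    have hH : ∫⁻ l in heights N, ENNReal.ofReal l * g l
        ≤ W ^ (1 / s) * (N ^ a / ENNReal.ofReal a) ^ (1 - 1 / s) := by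
      rw [hsplit]
      refine (ENNReal.lintegral_mul_norm_pow_le ?_ ?_ (by positivity) hq.le (by ring)).trans ?_
      · exact ((hg.pow_const _).mul
          (ENNReal.measurable_ofReal.comp (measurable_id.pow_const _))).aemeasurable
      · exact (ENNReal.measurable_ofReal.comp (measurable_id.pow_const _)).aemeasurable
      · gcongr
        exact setLIntegral_heights_le ha0 N
    calc (2 * ∫⁻ l in heights N, ENNReal.ofReal l * g l) ^ r
        ≤ (2 * (W ^ (1 / s) * (N ^ a / ENNReal.ofReal a) ^ (1 - 1 / s))) ^ r := by gcongr
      _ = c * ((N ^ (2 * r)) ^ (1 - r / s) * W ^ (r / s)) := by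
        rw [hcdef, ENNReal.div_eq_inv_mul, ENNReal.mul_rpow_of_nonneg _ _ hq.le,
          ENNReal.mul_rpow_of_nonneg _ _ hr0.le, ENNReal.mul_rpow_of_nonneg _ _ hr0.le,
          ENNReal.mul_rpow_of_nonneg _ _ hr0.le, ← ENNReal.rpow_mul W, ← ENNReal.rpow_mul N,
          ← ENNReal.rpow_mul N, ← ENNReal.rpow_mul N]
        have e1 : 1 / s * r = r / s := by ring
        have e2 : a * (1 - 1 / s) * r = 2 * r * (1 - r / s) := by
          rw [ha]; field_simp
        rw [e1, e2]
        ring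
  · refine ⟨2, fun N g _ => le_of_eq ?_⟩
    norm_num
    simp_rw [mul_comm]

/-! ### The Carleson embedding for tents -/

section

variable [MetricSpace M] [MeasurableSpace M] {μ : Measure M}

lemma IsDoublingSpace.sigmaFinite (hμ : IsDoublingSpace μ) : SigmaFinite μ := by
  rcases isEmpty_or_nonempty M with h | ⟨⟨x₀⟩⟩
  · rw [Measure.eq_zero_of_isEmpty μ]
    infer_instance
  · exact ⟨⟨{
      set := fun n : ℕ => ball x₀ (n + 1)
      set_mem := fun _ => trivial
      finite := fun n => hμ.lt_top _ _ (by positivity)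
      spanning := iUnion_ball_nat_succ x₀ }⟩⟩

/-- The Carleson embedding for functions supported in the tent over `O` below a fixed height. Every
vertical slice of the support lies in the Carleson box over a fourfold enlargement of one of the
disjoint balls selected by the Vitali covering lemma from all balls inside `O`. -/
lemma lintegral_rpow_le_of_tent_of_bounded [BorelSpace M] (hμ : IsDoublingSpace μ) {K : ℝ≥0}
    (hK : ∀ (x : M) (r : ℝ), 0 < r → μ (ball x (2 * r)) ≤ K * μ (ball x r)) {s : ℝ} (hs : 0 < s)
    {A : ℝ≥0∞} {Φ ψ : M × Ioi (0 : ℝ) → ℝ≥0∞} (hψ : Measurable ψ)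
    (hA : ∀ (c : M) (r : ℝ), 0 < r →
      ∫⁻ y in ball c r, (∫⁻ t in {t : Ioi (0 : ℝ) | (t : ℝ) < r ^ 2}, ψ (y, t) ∂dtOverT) ^ s ∂μ
        ≤ A * μ (ball c r))
    (hΦ : ∀ z, Φ z ≤ ψ z) {O : Set M}
    (hO : ∀ z, Φ z ≠ 0 → ball z.1 (Real.sqrt (z.2 : ℝ)) ⊆ O) {R : ℝ}
    (hR : ∀ z, Φ z ≠ 0 → Real.sqrt (z.2 : ℝ) ≤ R) :
    ∫⁻ y, (∫⁻ t, Φ (y, t) ∂dtOverT) ^ s ∂μ ≤ K ^ 2 * A * μ O := by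
  have := hμ.sigmaFinite
  obtain ⟨u, huT, hdisj, hcov⟩ := Vitali.exists_disjoint_subfamily_covering_enlargement
    (fun a : M × ℝ => ball a.1 a.2) {a | 0 < a.2 ∧ a.2 ≤ R ∧ ball a.1 a.2 ⊆ O} (fun a => a.2) 2
    one_lt_two (fun a ha => ha.1.le) R (fun a ha => ha.2.1) (fun a ha => nonempty_ball.2 ha.1)
  have hdisj' : Pairwise (Function.onFun Disjoint fun b : u => ball b.1.1 b.1.2) :=
    fun b c hbc => hdisj b.2 c.2 (fun h => hbc (Subtype.ext h))
  have hcount : Countable u := by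
    have h := Measure.countable_meas_pos_of_disjoint_iUnion (μ := μ)
      (fun b : u => (measurableSet_ball : MeasurableSet (ball b.1.1 b.1.2))) hdisj'
    rw [show {b : u | 0 < μ (ball b.1.1 b.1.2)} = univ from
      eq_univ_of_forall fun b => hμ.pos _ _ (huT b.2).1] at h
    exact countable_univ_iff.1 h
  set box : u → M → ℝ≥0∞ := fun b y =>
    (∫⁻ t in {t : Ioi (0 : ℝ) | (t : ℝ) < (2 * (2 * b.1.2)) ^ 2}, ψ (y, t) ∂dtOverT) ^ s with hbox
  have hpt : ∀ y, (∫⁻ t, Φ (y, t) ∂dtOverT) ^ s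
      ≤ ∑' b : u, (ball b.1.1 (2 * (2 * b.1.2))).indicator (box b) y := by
    intro y
    by_cases hne : ∃ t, Φ (y, t) ≠ 0
    · -- a point of the slice above `y` with almost maximal height
      obtain ⟨t₀, ht₀, hmax⟩ : ∃ t₀, Φ (y, t₀) ≠ 0 ∧ ∀ t, Φ (y, t) ≠ 0 →
          Real.sqrt (t : ℝ) < 2 * Real.sqrt (t₀ : ℝ) := by
        obtain ⟨t₁, ht₁⟩ := hne
        set S : Set ℝ := (fun t : Ioi (0 : ℝ) => Real.sqrt (t : ℝ)) '' {t | Φ (y, t) ≠ 0} with hS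
        have hbdd : BddAbove S := ⟨R, by rintro _ ⟨t, ht, rfl⟩; exact hR _ ht⟩
        have hpos : 0 < sSup S :=
          (Real.sqrt_pos.2 t₁.2).trans_le (le_csSup hbdd ⟨t₁, ht₁, rfl⟩)
        obtain ⟨_, ⟨t₀, ht₀, rfl⟩, hlt⟩ :=
          exists_lt_of_lt_csSup (s := S) ⟨_, t₁, ht₁, rfl⟩ (half_lt_self hpos)
        refine ⟨t₀, ht₀, fun t ht => ?_⟩
        have := le_csSup hbdd ⟨t, ht, rfl⟩
        simp only at this hlt
        linarith
      obtain ⟨b, hb, ⟨w, hw₁, hw₂⟩, hle⟩ :=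
        hcov (y, Real.sqrt t₀) ⟨Real.sqrt_pos.2 t₀.2, hR _ ht₀, hO _ ht₀⟩
      simp only [mem_ball] at hw₁ hw₂ hle
      have hy : y ∈ ball b.1 (2 * (2 * b.2)) := by
        have hb0 := (huT hb).1
        have := dist_triangle_left y b.1 w
        rw [mem_ball]
        linarith
      refine le_trans ?_ (ENNReal.le_tsum ⟨b, hb⟩)
      rw [indicator_of_mem hy, hbox]
      refine ENNReal.rpow_le_rpow ?_ hs.le
      have hsub : ∀ t, Φ (y, t) ≤
          {t : Ioi (0 : ℝ) | (t : ℝ) < (2 * (2 * b.2)) ^ 2}.indicator (fun t => ψ (y, t)) t := by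
        intro t
        by_cases ht : Φ (y, t) = 0
        · rw [ht]; exact zero_le
        · rw [indicator_of_mem]
          · exact hΦ _
          · have h1 : Real.sqrt (t : ℝ) < 2 * (2 * b.2) := (hmax t ht).trans_le (by linarith)
            exact (Real.sqrt_lt' ((Real.sqrt_nonneg _).trans_lt h1)).1 h1
      refine (lintegral_mono hsub).trans_eq (lintegral_indicator ?_ _)
      exact measurableSet_lt measurable_subtype_coe measurable_const
    · push Not at hne
      simp [hne, ENNReal.zero_rpow_of_pos hs]
  calc ∫⁻ y, (∫⁻ t, Φ (y, t) ∂dtOverT) ^ s ∂μ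
      ≤ ∫⁻ y, ∑' b : u, (ball b.1.1 (2 * (2 * b.1.2))).indicator (box b) y ∂μ := lintegral_mono hpt
    _ = ∑' b : u, ∫⁻ y in ball b.1.1 (2 * (2 * b.1.2)), box b y ∂μ := by
      rw [lintegral_tsum]
      · exact tsum_congr fun b => lintegral_indicator measurableSet_ball _
      · exact fun b => ((hψ.lintegral_prod_right'.pow_const s).indicator
          measurableSet_ball).aemeasurable
    _ ≤ ∑' b : u, K ^ 2 * A * μ (ball b.1.1 b.1.2) := by
      refine ENNReal.tsum_le_tsum fun b => ?_
      have hb0 := (huT b.2).1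
      calc ∫⁻ y in ball b.1.1 (2 * (2 * b.1.2)), box b y ∂μ
          ≤ A * μ (ball b.1.1 (2 * (2 * b.1.2))) := hA _ _ (by positivity)
        _ ≤ A * (K * (K * μ (ball b.1.1 b.1.2))) := by
          gcongr
          exact (hK _ _ (by positivity)).trans (by gcongr; exact hK _ _ hb0)
        _ = K ^ 2 * A * μ (ball b.1.1 b.1.2) := by ring
    _ ≤ K ^ 2 * A * μ O := by
      rw [ENNReal.tsum_mul_left]
      gcongr
      refine (tsum_meas_le_meas_iUnion_of_disjoint μ (fun _ => measurableSet_ball) hdisj').trans ?_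
      exact measure_mono (iUnion_subset fun b => (huT b.2).2.2)

/-- The Carleson embedding for functions supported in the tent over `O`, under an `L^s`
Carleson condition. It follows from the case of bounded height by monotone convergence: a set of
finite measure may contain arbitrarily large balls, so the truncation is really needed for the
Vitali covering lemma. -/
lemma lintegral_rpow_le_of_tent [BorelSpace M] (hμ : IsDoublingSpace μ) {K : ℝ≥0}
    (hK : ∀ (x : M) (r : ℝ), 0 < r → μ (ball x (2 * r)) ≤ K * μ (ball x r)) {s : ℝ} (hs : 0 < s)
    {A : ℝ≥0∞} {Φ ψ : M × Ioi (0 : ℝ) → ℝ≥0∞} (hψ : Measurable ψ) (hΦm : Measurable Φ)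
    (hA : ∀ (c : M) (r : ℝ), 0 < r →
      ∫⁻ y in ball c r, (∫⁻ t in {t : Ioi (0 : ℝ) | (t : ℝ) < r ^ 2}, ψ (y, t) ∂dtOverT) ^ s ∂μ
        ≤ A * μ (ball c r))
    (hΦ : ∀ z, Φ z ≤ ψ z) {O : Set M}
    (hO : ∀ z, Φ z ≠ 0 → ball z.1 (Real.sqrt (z.2 : ℝ)) ⊆ O) :
    ∫⁻ y, (∫⁻ t, Φ (y, t) ∂dtOverT) ^ s ∂μ ≤ K ^ 2 * A * μ O := by
  set E : ℕ → Set (M × Ioi (0 : ℝ)) := fun n => {z | Real.sqrt (z.2 : ℝ) ≤ n} with hE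
  have hEm : ∀ n, MeasurableSet (E n) := fun n => measurableSet_le
    (Real.continuous_sqrt.measurable.comp (measurable_subtype_coe.comp measurable_snd))
    measurable_const
  have hEmono : Monotone E := fun m n hmn z hz =>
    le_trans (b := (m : ℝ)) hz (Nat.cast_le.2 hmn)
  have hmono : ∀ z, Monotone fun n => (E n).indicator Φ z :=
    fun z m n hmn => indicator_le_indicator_of_subset (hEmono hmn) (fun _ => zero_le) z
  have hlim : ∀ z, Tendsto (fun n => (E n).indicator Φ z) atTop (𝓝 (Φ z)) := by
    intro z
    obtain ⟨n, hn⟩ := exists_nat_ge (Real.sqrt (z.2 : ℝ))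
    refine tendsto_const_nhds.congr' (eventually_atTop.2 ⟨n, fun m hm => ?_⟩)
    exact (indicator_of_mem (hEmono hm hn) _).symm
  have hmeas : ∀ n, Measurable ((E n).indicator Φ) := fun n => hΦm.indicator (hEm n)
  have hint : ∀ y, Tendsto (fun n => (∫⁻ t, (E n).indicator Φ (y, t) ∂dtOverT) ^ s) atTop
      (𝓝 ((∫⁻ t, Φ (y, t) ∂dtOverT) ^ s)) := fun y =>
    (ENNReal.continuous_rpow_const.tendsto _).comp <| lintegral_tendsto_of_tendsto_of_monotone
      (fun n => ((hmeas n).comp measurable_prodMk_left).aemeasurable)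
      (ae_of_all _ fun t => hmono _) (ae_of_all _ fun t => hlim _)
  refine le_of_tendsto' (lintegral_tendsto_of_tendsto_of_monotone
      (fun n => ((hmeas n).lintegral_prod_right'.pow_const s).aemeasurable)
      (ae_of_all _ fun y m n hmn => ?_) (ae_of_all _ hint)) fun n => ?_
  · exact ENNReal.rpow_le_rpow (lintegral_mono fun t => hmono _ hmn) hs.le
  · refine lintegral_rpow_le_of_tent_of_bounded hμ hK hs hψ hA
      (fun z => (indicator_le_self _ _ z).trans (hΦ z)) (fun z hz => hO z ?_) (R := n)
      (fun z hz => (mem_of_indicator_ne_zero hz : z ∈ E n))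
    rw [indicator_of_mem (mem_of_indicator_ne_zero hz)] at hz
    exact hz

/-- A bound on the Carleson function holds on every ball, since balls have positive measure. -/
lemma setLIntegral_le_of_carlesonFun (hμ : IsDoublingSpace μ) {q : ℝ} (hq : 0 < q)
    (G : M × Ioi (0 : ℝ) → ℂ) (c : M) {r : ℝ} (hr : 0 < r) :
    ∫⁻ y in ball c r, (∫⁻ t in {t : Ioi (0 : ℝ) | (t : ℝ) < r ^ 2}, ‖G (y, t)‖ₑ ^ 2 ∂dtOverT)
        ^ (q / 2) ∂μ
      ≤ eLpNorm (carlesonFun μ q G) ∞ μ ^ q * μ (ball c r) := by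
  have hpos := hμ.pos c r hr
  have hae : ∀ᵐ x ∂μ, carlesonFun μ q G x ≤ eLpNorm (carlesonFun μ q G) ∞ μ := by
    rw [eLpNorm_exponent_top]
    exact ae_le_eLpNormEssSup (f := carlesonFun μ q G)
  obtain ⟨x, hx, hxle⟩ : ∃ x ∈ ball c r, carlesonFun μ q G x ≤
      eLpNorm (carlesonFun μ q G) ∞ μ := by
    by_contra! h
    refine hpos.ne' (measure_mono_null (fun x hx => ?_) (ae_iff.1 hae))
    exact not_le.2 (h x hx)
  have h := le_trans (le_iSup₂_of_le c r (le_iSup₂_of_le hr hx le_rfl)) hxle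
  rw [setLAverage_eq, one_div, ENNReal.rpow_inv_le_iff hq] at h
  exact (ENNReal.div_le_iff hpos.ne' (hμ.lt_top c r hr).ne).1 h

end

/-! ### The non-tangential maximal function -/

section

variable [MetricSpace M]

lemma ball_subset_setOf_lt_nontangentialMax {F : M × Ioi (0 : ℝ) → ℂ} {c : ℝ≥0∞}
    {z : M × Ioi (0 : ℝ)} (hz : c < ‖F z‖ₑ) :
    ball z.1 (Real.sqrt (z.2 : ℝ)) ⊆ {x | c < nontangentialMax F x} := by
  intro x hx
  rw [mem_ball'] at hx
  exact hz.trans_le (le_iSup₂_of_le z hx le_rfl)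

lemma isOpen_setOf_lt_nontangentialMax (F : M × Ioi (0 : ℝ) → ℂ) (c : ℝ≥0∞) :
    IsOpen {x | c < nontangentialMax F x} := by
  have : {x | c < nontangentialMax F x}
      = ⋃ z ∈ {z | c < ‖F z‖ₑ}, ball z.1 (Real.sqrt (z.2 : ℝ)) := by
    refine Subset.antisymm (fun x (hx : c < nontangentialMax F x) => ?_)
      (iUnion₂_subset fun z hz => ball_subset_setOf_lt_nontangentialMax hz)
    obtain ⟨z, hz⟩ := lt_iSup_iff.1 hx
    obtain ⟨hzx, hz⟩ := lt_iSup_iff.1 hz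
    exact mem_iUnion₂.2 ⟨z, hz, mem_ball'.2 hzx⟩
  rw [this]
  exact isOpen_biUnion fun _ _ => isOpen_ball

lemma measurable_nontangentialMax [MeasurableSpace M] [BorelSpace M] (F : M × Ioi (0 : ℝ) → ℂ) :
    Measurable (nontangentialMax F) :=
  measurable_of_Ioi fun c => (isOpen_setOf_lt_nontangentialMax F c).measurableSet

lemma enorm_le_nontangentialMax (F : M × Ioi (0 : ℝ) → ℂ) (x : M) (t : Ioi (0 : ℝ)) :
    ‖F (x, t)‖ₑ ≤ nontangentialMax F x :=
  le_iSup₂_of_le (f := fun z (_ : z ∈ cone x) => ‖F z‖ₑ) (x, t)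
    (show dist x x < _ by rw [dist_self]; exact Real.sqrt_pos.2 t.2) le_rfl

end

/-! ### Integration over superlevel sets -/

/-- The layer cake estimate for `[0, ∞]`-valued functions. -/
lemma lintegral_rpow_mul_meas_lt_le [MeasurableSpace M] {μ : Measure M} [SFinite μ]
    {f : M → ℝ≥0∞} (hf : Measurable f) {a : ℝ} (ha : 0 < a) :
    ∫⁻ l in Ioi (0 : ℝ), ENNReal.ofReal (l ^ (a - 1)) * μ {x | ENNReal.ofReal l < f x}
      ≤ (ENNReal.ofReal a)⁻¹ * ∫⁻ x, f x ^ a ∂μ := by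
  have hS : MeasurableSet {w : ℝ × M | ENNReal.ofReal w.1 < f w.2} :=
    measurableSet_lt (ENNReal.measurable_ofReal.comp measurable_fst) (hf.comp measurable_snd)
  have hm : Measurable ({w : ℝ × M | ENNReal.ofReal w.1 < f w.2}.indicator
      fun w => ENNReal.ofReal (w.1 ^ (a - 1))) :=
    (ENNReal.measurable_ofReal.comp (measurable_fst.pow_const _)).indicator hS
  calc ∫⁻ l in Ioi (0 : ℝ), ENNReal.ofReal (l ^ (a - 1)) * μ {x | ENNReal.ofReal l < f x}
      = ∫⁻ l in Ioi (0 : ℝ), ∫⁻ x, {w : ℝ × M | ENNReal.ofReal w.1 < f w.2}.indicator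
          (fun w => ENNReal.ofReal (w.1 ^ (a - 1))) (l, x) ∂μ := by
        refine lintegral_congr fun l => ?_
        rw [← setLIntegral_const, ← lintegral_indicator (measurableSet_lt measurable_const hf)]
        rfl
    _ = ∫⁻ x, ∫⁻ l in Ioi (0 : ℝ), {w : ℝ × M | ENNReal.ofReal w.1 < f w.2}.indicator
          (fun w => ENNReal.ofReal (w.1 ^ (a - 1))) (l, x) ∂volume ∂μ :=
        lintegral_lintegral_swap hm.aemeasurable
    _ = ∫⁻ x, ∫⁻ l in heights (f x), ENNReal.ofReal (l ^ (a - 1)) ∂volume ∂μ := by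
        refine lintegral_congr fun x => ?_
        have hx : MeasurableSet {l : ℝ | ENNReal.ofReal l < f x} :=
          measurableSet_lt ENNReal.measurable_ofReal measurable_const
        rw [show heights (f x) = {l : ℝ | ENNReal.ofReal l < f x} ∩ Ioi 0 from inter_comm _ _,
          ← Measure.restrict_restrict hx, ← lintegral_indicator hx]
        rfl
    _ ≤ ∫⁻ x, (ENNReal.ofReal a)⁻¹ * f x ^ a ∂μ := by
        refine lintegral_mono fun x => ?_
        rw [← ENNReal.div_eq_inv_mul]
        exact setLIntegral_heights_le ha _
    _ = (ENNReal.ofReal a)⁻¹ * ∫⁻ x, f x ^ a ∂μ := lintegral_const_mul _ (hf.pow_const _)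

/-- The tent over a superlevel set of the non-tangential maximal function contains the corresponding
superlevel set of `F`, so the `L^s` Carleson condition bounds the superlevel integrals; integrating
the bound against a power of the height recovers a norm of the maximal function. -/
lemma lintegral_superlevelIntegral_le [MetricSpace M] [MeasurableSpace M] [BorelSpace M]
    {μ : Measure M} (hμ : IsDoublingSpace μ) {K : ℝ≥0}
    (hK : ∀ (x : M) (r : ℝ), 0 < r → μ (ball x (2 * r)) ≤ K * μ (ball x r)) {s a : ℝ} (hs : 0 < s)
    (ha : 0 < a) {F : M × Ioi (0 : ℝ) → ℂ} (hF : Measurable F) {ψ : M × Ioi (0 : ℝ) → ℝ≥0∞}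
    (hψ : Measurable ψ) {A : ℝ≥0∞}
    (hA : ∀ (c : M) (r : ℝ), 0 < r →
      ∫⁻ y in ball c r, (∫⁻ t in {t : Ioi (0 : ℝ) | (t : ℝ) < r ^ 2}, ψ (y, t) ∂dtOverT) ^ s ∂μ
        ≤ A * μ (ball c r)) :
    ∫⁻ x, ∫⁻ l in Ioi (0 : ℝ), superlevelIntegral (fun z => ‖F z‖ₑ) ψ l x ^ s *
        ENNReal.ofReal (l ^ (a - 1)) ∂volume ∂μ
      ≤ K ^ 2 * A * ((ENNReal.ofReal a)⁻¹ * ∫⁻ x, nontangentialMax F x ^ a ∂μ) := by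
  have := hμ.sigmaFinite
  have hg := measurable_superlevelIntegral hF.enorm hψ
  have hgl : ∀ l : ℝ, ∫⁻ x, superlevelIntegral (fun z => ‖F z‖ₑ) ψ l x ^ s ∂μ
      ≤ K ^ 2 * A * μ {x | ENNReal.ofReal l < nontangentialMax F x} := fun l =>
    lintegral_rpow_le_of_tent hμ hK hs hψ
      (hψ.indicator (measurableSet_lt measurable_const hF.enorm))
      hA (fun z => indicator_le_self _ _ z)
      (fun z hz => ball_subset_setOf_lt_nontangentialMax
        (mem_of_indicator_ne_zero hz : z ∈ {z | ENNReal.ofReal l < ‖F z‖ₑ}))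
  have hpow : Measurable fun l : ℝ => ENNReal.ofReal (l ^ (a - 1)) :=
    ENNReal.measurable_ofReal.comp (measurable_id.pow_const _)
  have hm : Measurable fun w : M × ℝ => superlevelIntegral (fun z => ‖F z‖ₑ) ψ w.2 w.1 ^ s *
      ENNReal.ofReal (w.2 ^ (a - 1)) :=
    ((hg.comp measurable_swap).pow_const s).mul (hpow.comp measurable_snd)
  rw [lintegral_lintegral_swap hm.aemeasurable]
  calc ∫⁻ l in Ioi (0 : ℝ), ∫⁻ x, superlevelIntegral (fun z => ‖F z‖ₑ) ψ l x ^ s *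
        ENNReal.ofReal (l ^ (a - 1)) ∂μ
      ≤ ∫⁻ l in Ioi (0 : ℝ), K ^ 2 * A * (ENNReal.ofReal (l ^ (a - 1)) *
          μ {x | ENNReal.ofReal l < nontangentialMax F x}) := by
        refine lintegral_mono fun l => ?_
        have hl : Measurable fun x => superlevelIntegral (fun z => ‖F z‖ₑ) ψ l x :=
          hg.comp measurable_prodMk_left
        rw [lintegral_mul_const _ (hl.pow_const s)]
        calc _ ≤ K ^ 2 * A * μ {x | ENNReal.ofReal l < nontangentialMax F x} *
              ENNReal.ofReal (l ^ (a - 1)) := by gcongr; exact hgl l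
          _ = _ := by ring
    _ = K ^ 2 * A * ∫⁻ l in Ioi (0 : ℝ), ENNReal.ofReal (l ^ (a - 1)) *
          μ {x | ENNReal.ofReal l < nontangentialMax F x} := by
        refine lintegral_const_mul _ (hpow.mul ?_)
        exact measurable_measure_prodMk_left (measurableSet_lt
          (ENNReal.measurable_ofReal.comp measurable_fst)
          ((measurable_nontangentialMax F).comp measurable_snd))
    _ ≤ _ := by
        gcongr
        exact lintegral_rpow_mul_meas_lt_le (measurable_nontangentialMax F) ha

end CarlesonDuality

end

theorem mainTheorem7 {M : Type*} [MetricSpace M] [MeasurableSpace M] [BorelSpace M]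
    (μ : Measure M) (hμ : CarlesonDuality.IsDoublingSpace μ)
    (p : ℝ) (hp : 2 ≤ p) (ε : ℝ) (hε : 0 < ε ∨ (p = 2 ∧ ε = 0)) :
    ∃ C : ℝ≥0, 0 < C ∧ ∀ F G : M × Ioi (0 : ℝ) → ℂ, Measurable F → Measurable G →
      (∫⁻ x, (∫⁻ t, ‖F (x, t)‖ₑ ^ 2 * ‖G (x, t)‖ₑ ^ 2 ∂CarlesonDuality.dtOverT) ^ (p / 2) ∂μ)
          ^ (1 / p)
        ≤ C * eLpNorm (CarlesonDuality.nontangentialMax F) (ENNReal.ofReal p) μ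
            * eLpNorm (CarlesonDuality.carlesonFun μ (p + ε) G) ∞ μ := by
  open CarlesonDuality in
  obtain ⟨K, hK⟩ := hμ.doubling
  have := hμ.sigmaFinite
  have hp0 : 0 < p := by linarith
  have hε0 : 0 ≤ ε := by rcases hε with h | h <;> linarith
  have hs0 : 0 < (p + ε) / 2 := by linarith
  obtain ⟨C₀, hC₀⟩ := exists_rpow_setLIntegral_heights_le (r := p / 2) (s := (p + ε) / 2)
    (by linarith) (hε.imp (fun h => by linarith) fun h => ⟨by linarith, by linarith⟩)
  rw [mul_div_cancel₀ p two_ne_zero, div_div_div_cancel_right₀ two_ne_zero] at hC₀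
  have hθ0 : 0 ≤ p / (p + ε) := by positivity
  have hθ1 : 0 ≤ 1 - p / (p + ε) := by
    rw [sub_nonneg, div_le_one (by linarith)]; linarith
  set c : ℝ≥0∞ := (C₀ * (K ^ 2 * (ENNReal.ofReal p)⁻¹) ^ (p / (p + ε))) ^ (1 / p) with hc
  have hctop : c ≠ ∞ := by
    refine ENNReal.rpow_ne_top_of_nonneg (by positivity) (ENNReal.mul_ne_top ENNReal.coe_ne_top
      (ENNReal.rpow_ne_top_of_nonneg hθ0 (ENNReal.mul_ne_top (by finiteness) ?_)))
    exact ENNReal.inv_ne_top.2 (ENNReal.ofReal_pos.2 hp0).ne'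
  refine ⟨c.toNNReal + 1, by positivity, fun F G hF hG => ?_⟩
  set N := nontangentialMax F with hN
  have hNm : Measurable N := measurable_nontangentialMax F
  set a := eLpNorm (carlesonFun μ (p + ε) G) ∞ μ with ha
  set I := ∫⁻ x, N x ^ p ∂μ with hI
  set ψ : M × Ioi (0 : ℝ) → ℝ≥0∞ := fun z => ‖G z‖ₑ ^ 2 with hψdef
  have hψ : Measurable ψ := hG.enorm.pow_const 2
  set W : M → ℝ≥0∞ := fun x => ∫⁻ l in Ioi (0 : ℝ),
    superlevelIntegral (fun z => ‖F z‖ₑ) ψ l x ^ ((p + ε) / 2) * ENNReal.ofReal (l ^ (p - 1))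
    with hW
  have hWm : Measurable W := by
    refine Measurable.lintegral_prod_right' (f := fun w : M × ℝ =>
      superlevelIntegral (fun z => ‖F z‖ₑ) ψ w.2 w.1 ^ ((p + ε) / 2) *
        ENNReal.ofReal (w.2 ^ (p - 1))) ?_
    exact (((measurable_superlevelIntegral hF.enorm hψ).comp measurable_swap).pow_const _).mul
      (ENNReal.measurable_ofReal.comp (measurable_snd.pow_const _))
  have hWI : ∫⁻ x, W x ∂μ ≤ K ^ 2 * (ENNReal.ofReal p)⁻¹ * a ^ (p + ε) * I := by
    refine (lintegral_superlevelIntegral_le hμ hK hs0 hp0 hF hψ fun c r hr =>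
      setLIntegral_le_of_carlesonFun hμ (by linarith) G c hr).trans_eq ?_
    rw [← ha, ← hN, ← hI]
    ring
  have hpt : ∀ x, (∫⁻ t, ‖F (x, t)‖ₑ ^ 2 * ‖G (x, t)‖ₑ ^ 2 ∂dtOverT) ^ (p / 2)
      ≤ C₀ * ((N x ^ p) ^ (1 - p / (p + ε)) * W x ^ (p / (p + ε))) := by
    intro x
    have h := lintegral_sq_mul_eq_superlevelIntegral hF.enorm hψ (fun z => enorm_ne_top)
      (enorm_le_nontangentialMax F x)
    simp only [hψdef] at h
    rw [h]
    refine (hC₀ (N x) _ (measurable_superlevelIntegral_right hF.enorm hψ x)).trans ?_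
    gcongr
    exact lintegral_mono_set fun l hl => hl.1
  have hmain : ∫⁻ x, (∫⁻ t, ‖F (x, t)‖ₑ ^ 2 * ‖G (x, t)‖ₑ ^ 2 ∂dtOverT) ^ (p / 2) ∂μ
      ≤ C₀ * (K ^ 2 * (ENNReal.ofReal p)⁻¹) ^ (p / (p + ε)) * I * a ^ p := by
    calc _ ≤ C₀ * ∫⁻ x, (N x ^ p) ^ (1 - p / (p + ε)) * W x ^ (p / (p + ε)) ∂μ :=
          (lintegral_mono hpt).trans_eq (lintegral_const_mul _
            (((hNm.pow_const _).pow_const _).mul (hWm.pow_const _)))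
      _ ≤ C₀ * (I ^ (1 - p / (p + ε)) * (∫⁻ x, W x ∂μ) ^ (p / (p + ε))) := by
          gcongr
          exact ENNReal.lintegral_mul_norm_pow_le (hNm.pow_const _).aemeasurable hWm.aemeasurable
            hθ1 hθ0 (by ring)
      _ ≤ C₀ * (I ^ (1 - p / (p + ε)) *
            (K ^ 2 * (ENNReal.ofReal p)⁻¹ * a ^ (p + ε) * I) ^ (p / (p + ε))) := by gcongr
      _ = C₀ * (K ^ 2 * (ENNReal.ofReal p)⁻¹) ^ (p / (p + ε)) *
            (I ^ (1 - p / (p + ε)) * I ^ (p / (p + ε))) * a ^ p := by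
          rw [ENNReal.mul_rpow_of_nonneg _ _ hθ0, ENNReal.mul_rpow_of_nonneg _ _ hθ0,
            ← ENNReal.rpow_mul a, mul_div_cancel₀ p (by linarith : p + ε ≠ 0)]
          ring
      _ = _ := by
          rw [← ENNReal.rpow_add_of_nonneg _ _ hθ1 hθ0, sub_add_cancel, ENNReal.rpow_one]
  have hnorm : eLpNorm N (ENNReal.ofReal p) μ = I ^ (1 / p) := by
    rw [eLpNorm_eq_lintegral_rpow_enorm_toReal (ENNReal.ofReal_pos.2 hp0).ne'
      ENNReal.ofReal_ne_top, ENNReal.toReal_ofReal hp0.le]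
    simp [hI]
  have hp1 : 0 ≤ 1 / p := by positivity
  calc _ ≤ (C₀ * (K ^ 2 * (ENNReal.ofReal p)⁻¹) ^ (p / (p + ε)) * I * a ^ p) ^ (1 / p) := by
        gcongr
    _ = c * I ^ (1 / p) * a := by
        rw [ENNReal.mul_rpow_of_nonneg _ _ hp1, ENNReal.mul_rpow_of_nonneg _ _ hp1,
          ← ENNReal.rpow_mul a, mul_one_div_cancel hp0.ne', ENNReal.rpow_one]
    _ ≤ _ := by
        rw [hnorm]
        gcongr
        rw [ENNReal.coe_add, ENNReal.coe_toNNReal hctop]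
        exact le_self_add
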